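/- Let $D$ be a noncommutative division ring of characteristic different from $2$, and let $n > 2$ be an integer. Let $f, g \colon D \to D$ be additive maps such that $f(x) = x^n g(x^{-1})$ for all $x \in D^{\times}$, where $D^{\times} = D \setminus \{0\}$ is the group of units of $D$. Then $f = -g$, that is, $f(x) = -g(x)$ for all $x \in D$. -/

import Mathlib

/-! The sum `h = f + g` satisfies `h x = x ^ n * h x⁻¹`, and a Hua-type identity shows that such an
`h` is determined by `h 1`. So the claim is `h 1 = 0`. In characteristic 0, evaluating at 2
suffices. In characteristic p, suppose `h 1 ≠ 0` and scale to `h 1 = 1`. Uniqueness makes `h`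
commute with conjugations, hence `h x = l * x + (central)` with `l` central. If `l = 0`, all `x ^ n`
are central. If `l ≠ 0`, the values of `h` on the center force `n = p ^ k + 1`, and then all `x ^ p
^ k` are central. In both cases `D` is algebraic over its center, which is therefore infinite, and
some fixed p-power maps `D` into the center, against Jacobson–Noether. -/

/-- An additive map that is fixed by the twisted inversion `h ↦ (x ↦ x ^ n * h x⁻¹)`. -/
def InversionSymmetric {D : Type*} [DivisionRing D] (n : ℕ) (h : D →+ D) : Prop :=
  ∀ x : D, x ≠ 0 → h x = x ^ n * h x⁻¹

/-! ### Uniqueness and functional identities. -/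

namespace InversionSymmetric

variable {D : Type*} [DivisionRing D] {n : ℕ} {h : D →+ D}

/-- As `h 1 = 0`, shifting by 1 is invisible to `h`. Since `(1 + x⁻¹)⁻¹ = 1 - (x + 1)⁻¹`, both `h x`
and `h x⁻¹` are expressed through `h (x + 1)⁻¹`, with opposite signs. -/
theorem apply_eq_zero (hs : InversionSymmetric n h) (h2 : (2 : D) ≠ 0) (h1 : h 1 = 0) (x : D) :
    h x = 0 := by
  rcases eq_or_ne x 0 with rfl | hx
  · exact map_zero h
  rcases eq_or_ne (x + 1) 0 with hx1 | hx1
  · rw [eq_neg_of_add_eq_zero_left hx1, map_neg, h1, neg_zero]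
  have hfac : 1 + x⁻¹ = x⁻¹ * (x + 1) := by rw [mul_add, inv_mul_cancel₀ hx, mul_one]
  have hne : 1 + x⁻¹ ≠ 0 := hfac ▸ mul_ne_zero (inv_ne_zero hx) hx1
  have hinv : (1 + x⁻¹)⁻¹ = 1 - (x + 1)⁻¹ := by
    rw [hfac, mul_inv_rev, inv_inv, eq_sub_iff_add_eq]
    nth_rewrite 2 [← mul_one (x + 1)⁻¹]
    rw [← mul_add, inv_mul_cancel₀ hx1]
  have e1 : h x = (x + 1) ^ n * h (x + 1)⁻¹ := by
    rw [← hs _ hx1, map_add, h1, add_zero]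
  have e2 : h x⁻¹ = -((1 + x⁻¹) ^ n * h (x + 1)⁻¹) := by
    have := hs _ hne
    rwa [hinv, map_sub, h1, zero_sub, map_add, h1, zero_add, mul_neg] at this
  have hc : Commute x (1 + x⁻¹) := (Commute.one_right x).add_right (Commute.refl x).inv_right₀
  have e3 : h x = -h x := by
    conv_lhs => rw [hs x hx, e2, mul_neg, ← mul_assoc, ← hc.mul_pow, hfac, ← mul_assoc,
      mul_inv_cancel₀ hx, one_mul, ← e1]
  have : 2 * h x = 0 := by rw [two_mul]; nth_rewrite 1 [e3]; exact neg_add_cancel _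
  exact (mul_eq_zero.mp this).resolve_left h2

theorem apply_unique (hs : InversionSymmetric n h) {k : D →+ D} (ks : InversionSymmetric n k)
    (h2 : (2 : D) ≠ 0) (h1 : h 1 = k 1) (x : D) : h x = k x := by
  have hd : InversionSymmetric n (h - k) := fun x hx => by
    rw [AddMonoidHom.sub_apply, AddMonoidHom.sub_apply, hs x hx, ks x hx, mul_sub]
  exact sub_eq_zero.mp (hd.apply_eq_zero h2 (by simp [h1]) x)

theorem two_pow_mul_apply_one (hs : InversionSymmetric n h) (h2 : (2 : D) ≠ 0) (hn : 2 ≤ n) :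
    ((2 : D) ^ (n - 2) - 1) * h 1 = 0 := by
  have e1 : h 2 = 2 * h 1 := by rw [← one_add_one_eq_two, map_add, add_mul, one_mul]
  have e2 : 2 * h 2⁻¹ = h 1 := by
    rw [two_mul, ← map_add, ← two_mul, mul_inv_cancel₀ h2]
  have e3 := hs 2 h2
  have e4 : (2 : D) ^ 2 * ((2 : D) ^ (n - 2) * h 1) = 2 ^ 2 * h 1 := by
    calc (2 : D) ^ 2 * ((2 : D) ^ (n - 2) * h 1) = 2 ^ n * (2 * h 2⁻¹) := by
          rw [e2, ← mul_assoc, ← pow_add, Nat.add_sub_cancel' hn]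
      _ = 2 * (2 ^ n * h 2⁻¹) := by rw [← mul_assoc, ← mul_assoc, ← pow_succ, ← pow_succ']
      _ = 2 ^ 2 * h 1 := by rw [← e3, e1, ← mul_assoc, pow_two]
  rw [sub_mul, one_mul, mul_left_cancel₀ (pow_ne_zero 2 h2) e4, sub_self]

theorem mul_right (hs : InversionSymmetric n h) (d : D) :
    InversionSymmetric n ((AddMonoidHom.mulRight d).comp h) := fun x hx => by
  simp [hs x hx, mul_assoc]

/-- The conjugated map has the same symmetry and the same value at 1. -/
theorem apply_conj (hs : InversionSymmetric n h) (h2 : (2 : D) ≠ 0) (h1 : h 1 = 1) {u : D}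
    (hu : u ≠ 0) (x : D) : h (u * x * u⁻¹) = u * h x * u⁻¹ := by
  let k : D →+ D := (AddMonoidHom.mulRight u).comp ((AddMonoidHom.mulLeft u⁻¹).comp
    (h.comp ((AddMonoidHom.mulRight u⁻¹).comp (AddMonoidHom.mulLeft u))))
  have hk (x) : k x = u⁻¹ * h (u * x * u⁻¹) * u := rfl
  have ks : InversionSymmetric n k := fun x hx => by
    have hne : u * x * u⁻¹ ≠ 0 := mul_ne_zero (mul_ne_zero hu hx) (inv_ne_zero hu)
    rw [hk, hk, hs _ hne]
    have e : u * x⁻¹ * u⁻¹ = (u * x * u⁻¹)⁻¹ := by simp [mul_inv_rev, mul_assoc]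
    have e' := GroupWithZero.conj_pow₀ (s := n) (d := x) (inv_ne_zero hu)
    rw [inv_inv] at e'
    rw [e, e']
    simp only [mul_assoc, inv_mul_cancel_left₀ hu]
  have := hs.apply_unique ks h2 (by rw [hk, mul_one, mul_inv_cancel₀ hu, h1]; simp [hu]) x
  rw [this, hk]
  simp only [mul_assoc, mul_inv_cancel_left₀ hu, mul_inv_cancel₀ hu, mul_one]

theorem apply_commutator (hs : InversionSymmetric n h) (h2 : (2 : D) ≠ 0) (h1 : h 1 = 1)
    (x u : D) : h x * u - u * h x = h (x * u - u * x) := by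
  have key : ∀ u : D, u ≠ 0 → h (u * x) * u = u * h (x * u) := fun u hu => by
    have := hs.apply_conj h2 h1 hu (x * u)
    rw [← mul_assoc, mul_inv_cancel_right₀ hu] at this
    rw [this, inv_mul_cancel_right₀ hu]
  rcases eq_or_ne u 0 with rfl | hu
  · simp
  rcases eq_or_ne (u + 1) 0 with hu1 | hu1
  · simp [eq_neg_of_add_eq_zero_left hu1]
  -- Linearization: subtracting `key` at `u` from `key` at `u + 1` leaves the commutator identity.
  have e := key _ hu1
  have e0 := key _ hu
  simp only [add_mul, mul_add, one_mul, mul_one, map_add, map_sub] at e ⊢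
  rw [e0] at e
  rw [sub_eq_sub_iff_add_eq_add]
  have := add_right_cancel (b := h x) (a := u * h (x * u) + h x * u + h (u * x))
    (c := u * h (x * u) + u * h x + h (x * u)) (by rw [add_assoc, e]; abel)
  rw [add_assoc, add_assoc] at this
  rw [add_left_cancel this, add_comm]

/-- Apply the symmetry to `x * (x + 1)`, whose inverse is `x⁻¹ - (x + 1)⁻¹`. -/
theorem apply_sq (hs : InversionSymmetric n h) (hn : n ≠ 0) (h1 : h 1 = 1) (x : D) :
    h (x ^ 2) = ((x + 1) ^ n - x ^ n - 1) * h x - x ^ n := by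
  rcases eq_or_ne x 0 with rfl | hx
  · simp [hn]
  rcases eq_or_ne (x + 1) 0 with hx1 | hx1
  · rw [hx1]
    have : x = -1 := eq_neg_of_add_eq_zero_left hx1
    subst this
    simp [hn, h1]
  have hc : Commute x (x + 1) := (Commute.refl x).add_right (Commute.one_right x)
  have e0 : x ^ 2 + x = x * (x + 1) := by rw [pow_two, mul_add, mul_one]
  have e1 : (x * (x + 1))⁻¹ = x⁻¹ - (x + 1)⁻¹ := by
    rw [hc.inv_sub_inv hx hx1]; simp [hc.eq, mul_inv_rev]
  have e2 := hs _ (mul_ne_zero hx hx1)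
  rw [e1, map_sub, mul_sub, hc.mul_pow, ← e0, map_add, mul_assoc _ _ (h (x + 1)⁻¹), ← hs _ hx1,
    (hc.pow_pow n n).eq, mul_assoc, ← hs _ hx, map_add, h1] at e2
  rw [eq_sub_of_add_eq e2]
  noncomm_ring

/-- Both sides are inversion symmetric in `x` and equal `2 * h z` at 1. -/
theorem apply_central_mul (hs : InversionSymmetric n h) (h2 : (2 : D) ≠ 0) (h1 : h 1 = 1)
    {z : D} (hz : z ∈ Subring.center D) (hz0 : z ≠ 0) (x : D) :
    h (z * x) + z ^ n * h (z⁻¹ * x) = 2 * (h x * h z) := by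
  have hcz (y : D) : Commute z y := (Subring.mem_center_iff.mp hz y).symm
  let k : D →+ D := h.comp (AddMonoidHom.mulLeft z) +
    (AddMonoidHom.mulLeft (z ^ n)).comp (h.comp (AddMonoidHom.mulLeft z⁻¹))
  have hk (x) : k x = h (z * x) + z ^ n * h (z⁻¹ * x) := rfl
  have ks : InversionSymmetric n k := fun x hx => by
    rw [hk, hk, hs _ (mul_ne_zero hz0 hx), hs _ (mul_ne_zero (inv_ne_zero hz0) hx), mul_inv_rev,
      mul_inv_rev, inv_inv, (hcz x).mul_pow, (hcz x).inv_left₀.mul_pow, ((hcz x⁻¹).inv_left₀).eq,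
      (hcz x⁻¹).eq, mul_add, add_comm]
    congr 1
    · rw [← mul_assoc, ← mul_assoc, inv_pow, mul_inv_cancel₀ (pow_ne_zero n hz0), one_mul]
    · rw [← mul_assoc, ((hcz x).pow_pow n n).eq]
  have := ks.apply_unique (hs.mul_right (2 * h z)) h2 (by
    rw [hk, mul_one, mul_one, ← hs z hz0]; simp [h1, two_mul]) x
  rw [← hk, this]
  simp [two_mul, mul_add]

end InversionSymmetric

/-! ### Commuting additive maps. -/

/-- A commuting additive map on a noncommutative division ring is a central multiple of the
identity plus a map with central values. -/
theorem exists_central_mul_add_of_commuting {D : Type*} [DivisionRing D]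
    (hnc : ∃ a b : D, a * b ≠ b * a) (h : D →+ D)
    (hh : ∀ x y, h x * y - y * h x = x * h y - h y * x) :
    ∃ l ∈ Subring.center D, ∀ x, h x - l * x ∈ Subring.center D := by
  obtain ⟨a, b, hab⟩ := hnc
  have hab' : a * b - b * a ≠ 0 := sub_ne_zero.mpr hab
  set B : D → D → D := fun x y => h x * y - y * h x with hB
  have hBl (x u w) : B (x * u) w = x * B u w + B x w * u := by
    simp only [hB, hh]; noncomm_ring
  have hBr (w y v) : B w (y * v) = y * B w v + B w y * v := by
    simp only [hB]; noncomm_ring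
  -- `B` is a derivation in each argument; expanding `B (x * u) (y * v)` in both orders gives this.
  have key (x u y v) : (x * y - y * x) * B u v = B x y * (u * v - v * u) := by
    have e : B (x * u) (y * v) = B (x * u) (y * v) := rfl
    conv_lhs at e => rw [hBl, hBr, hBr]
    conv_rhs at e => rw [hBr, hBl, hBl]
    rw [← sub_eq_zero] at e ⊢
    rw [← e]
    noncomm_ring
  have key2 (x u y v z) : (x * y - y * x) * z * B u v = B x y * z * (u * v - v * u) := by
    have e := key x (z * u) y v
    have e' := key x z y v
    rw [hBl, mul_add, ← mul_assoc, ← mul_assoc, e'] at e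
    rw [eq_sub_of_add_eq e]
    noncomm_ring
  set l := B a b * (a * b - b * a)⁻¹ with hl
  have hBxy (x y) : B x y = (x * y - y * x) * l := by
    rw [hl, ← mul_assoc, key x a y b, mul_inv_cancel_right₀ hab']
  have hlc : l ∈ Subring.center D := by
    rw [Subring.mem_center_iff]
    intro z
    have e := key2 a a b b z
    rw [hBxy a b, mul_assoc _ l, mul_assoc, mul_assoc] at e
    have e := mul_left_cancel₀ hab' e
    have e' : B a b = l * (a * b - b * a) := by rw [hl, inv_mul_cancel_right₀ hab']
    rw [← hBxy, e', ← mul_assoc] at e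
    exact mul_right_cancel₀ hab' e
  refine ⟨l, hlc, fun x => Subring.mem_center_iff.mpr fun y => ?_⟩
  have e := hBxy x y
  rw [Subring.mem_center_iff.mp hlc] at e
  simp only [hB] at e
  have hy := Subring.mem_center_iff.mp hlc y
  rw [← sub_eq_zero] at e ⊢
  rw [← neg_eq_zero, ← e, mul_sub, sub_mul, ← mul_assoc, hy]
  noncomm_ring

/-! ### Algebraic division rings have infinite center. -/

open Polynomial in
/-- Herstein's lemma: an element which is algebraic over a finite center and not central is
conjugate to a different element of the algebra it generates. -/
theorem exists_mul_eq_mul_of_finite_center {D : Type*} [DivisionRing D]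
    [Finite (Subring.center D)] {a : D} (ha : IsIntegral (Subring.center D) a)
    (hac : a ∉ Subring.center D) :
    ∃ c ∈ Algebra.adjoin (Subring.center D) {a}, ∃ y : D, y ≠ 0 ∧ c ≠ a ∧ y * a = c * y := by
  classical
  let K := Algebra.adjoin (Subring.center D) {a}
  have : Module.Finite (Subring.center D) K := Module.Finite.iff_fg.mpr ha.fg_adjoin_singleton
  have : Finite K := Module.finite_of_finite (Subring.center D)
  let _ : Field K := (Finite.isDomain_to_isField K).toField
  let _ : Fintype K := Fintype.ofFinite K
  let a' : K := ⟨a, Algebra.self_mem_adjoin_singleton _ a⟩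
  -- Right multiplication by `a` is linear over the finite field `K` acting on the left, and is
  -- killed by `X ^ |K| - X`, the product of all `X - c`.
  let R : Module.End K D :=
    { toFun := fun y => y * a
      map_add' := fun x y => add_mul x y a
      map_smul' := fun k y => mul_assoc (k : D) y a }
  have hR (y : D) : R y = y * a := rfl
  have hRpow (m : ℕ) (y : D) : (R ^ m) y = y * a ^ m := by
    induction m generalizing y with
    | zero => simp
    | succ m ih => rw [pow_succ, Module.End.mul_apply, ih, hR, mul_assoc, pow_succ']
  have hprod : ∏ c : K, (X - C c) = X ^ Fintype.card K - X := by
    have hmon : (X ^ Fintype.card K - X : K[X]).Monic :=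
      monic_X_pow_sub (by rw [degree_X]; exact_mod_cast Fintype.one_lt_card)
    have := prod_multiset_X_sub_C_of_monic_of_roots_card_eq hmon (by
      rw [FiniteField.roots_X_pow_card_sub_X, FiniteField.X_pow_card_sub_X_natDegree_eq _
        Fintype.one_lt_card]; rfl)
    rwa [FiniteField.roots_X_pow_card_sub_X] at this
  have hfac (c : K) (y : D) : aeval R (X - C c) y = y * a - c * y := by
    rw [map_sub, aeval_X, aeval_C, LinearMap.sub_apply, hR]; rfl
  have hzero (y : D) : aeval R (∏ c : K, (X - C c)) y = 0 := by
    have e : (a' : D) ^ Fintype.card K = a' := congrArg Subtype.val (FiniteField.pow_card a')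
    rw [hprod, map_sub, map_pow, aeval_X, LinearMap.sub_apply, hRpow, hR, sub_eq_zero]
    exact congrArg (y * ·) e
  have hex : ∀ (s : Finset K) (w : D), w ≠ 0 → aeval R (∏ c ∈ s, (X - C c)) w = 0 →
      ∃ c ∈ s, ∃ y : D, y ≠ 0 ∧ y * a = c * y := by
    intro s
    induction s using Finset.induction_on with
    | empty => intro w hw h; exact absurd (by simpa using h) hw
    | insert c s hc ih =>
      intro w hw h
      rw [Finset.prod_insert hc, mul_comm, map_mul, Module.End.mul_apply] at h
      rcases eq_or_ne (aeval R (X - C c) w) 0 with h0 | h0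
      · exact ⟨c, Finset.mem_insert_self _ _, w, hw, sub_eq_zero.mp (hfac c w ▸ h0)⟩
      · obtain ⟨d, hd, y, hy⟩ := ih _ h0 h
        exact ⟨d, Finset.mem_insert_of_mem hd, y, hy⟩
  obtain ⟨b, hb⟩ : ∃ b, b * a ≠ a * b := by
    by_contra! h; exact hac (Subring.mem_center_iff.mpr h)
  -- The factor of `a'` sends `b` to a nonzero vector, which the remaining factors kill.
  obtain ⟨c, hc, y, hy, hyc⟩ := hex (Finset.univ.erase a') (b * a - a * b) (sub_ne_zero.mpr hb) (by
    have := hzero b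
    rwa [← Finset.prod_erase_mul _ _ (Finset.mem_univ a'), map_mul, Module.End.mul_apply,
      hfac] at this)
  exact ⟨c, c.2, y, hy, fun h => Finset.ne_of_mem_erase hc (Subtype.ext h), hyc⟩

/-- With a finite center, `y * a = c * y` makes `K * L` a finite space stable under `a` and `y`. The
algebra they generate is then finite, so commutative by Wedderburn, forcing `c = a`. -/
theorem not_finite_center {D : Type*} [DivisionRing D] (hnc : ∃ a b : D, a * b ≠ b * a)
    (halg : ∀ x : D, IsIntegral (Subring.center D) x) : Infinite (Subring.center D) := by
  by_contra hfin
  rw [not_infinite_iff_finite] at hfin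
  obtain ⟨a, b, hab⟩ := hnc
  have hac : a ∉ Subring.center D := fun h => hab ((Subring.mem_center_iff.mp h b).symm)
  obtain ⟨c, hc, y, hy, hca, hyc⟩ := exists_mul_eq_mul_of_finite_center (halg a) hac
  let Z := Subring.center D
  let K := Algebra.adjoin Z {a}
  let L := Algebra.adjoin Z {y}
  let A := Algebra.adjoin Z {a, y}
  let M : Submodule Z D := Subalgebra.toSubmodule K * Subalgebra.toSubmodule L
  have hM : M.FG := (halg a).fg_adjoin_singleton.mul (halg y).fg_adjoin_singleton
  have hyK : ∀ k ∈ K, ∃ k' ∈ K, y * k = k' * y := by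
    intro k hk
    induction hk using Algebra.adjoin_induction with
    | mem x hx => rw [Set.mem_singleton_iff.mp hx]; exact ⟨c, hc, hyc⟩
    | algebraMap r =>
      exact ⟨algebraMap Z D r, K.algebraMap_mem r, (Algebra.commutes r y).symm⟩
    | add p q _ _ hp hq =>
      obtain ⟨p', hp', ep⟩ := hp
      obtain ⟨q', hq', eq⟩ := hq
      exact ⟨p' + q', K.add_mem hp' hq', by rw [mul_add, add_mul, ep, eq]⟩
    | mul p q _ _ hp hq =>
      obtain ⟨p', hp', ep⟩ := hp
      obtain ⟨q', hq', eq⟩ := hq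
      exact ⟨p' * q', K.mul_mem hp' hq', by rw [← mul_assoc, ep, mul_assoc, eq, mul_assoc]⟩
  have haM : ∀ m ∈ M, a * m ∈ M := fun m hm => by
    induction hm using Submodule.mul_induction_on' with
    | mem_mul_mem k hk l hl =>
      rw [← mul_assoc]
      exact Submodule.mul_mem_mul (K.mul_mem (Algebra.self_mem_adjoin_singleton Z a) hk) hl
    | add p _ q _ hp hq => rw [mul_add]; exact M.add_mem hp hq
  have hyM : ∀ m ∈ M, y * m ∈ M := fun m hm => by
    induction hm using Submodule.mul_induction_on' with
    | mem_mul_mem k hk l hl =>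
      obtain ⟨k', hk', e⟩ := hyK k hk
      rw [← mul_assoc, e, mul_assoc]
      exact Submodule.mul_mem_mul hk' (L.mul_mem (Algebra.self_mem_adjoin_singleton Z y) hl)
    | add p _ q _ hp hq => rw [mul_add]; exact M.add_mem hp hq
  have hAM : ∀ s ∈ A, ∀ m ∈ M, s * m ∈ M := by
    intro s hs
    induction hs using Algebra.adjoin_induction with
    | mem x hx =>
      rcases hx with rfl | hx
      · exact haM
      · rw [Set.mem_singleton_iff.mp hx]; exact hyM
    | algebraMap r => intro m hm; rw [← Algebra.smul_def]; exact M.smul_mem r hm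
    | add p q _ _ hp hq => intro m hm; rw [add_mul]; exact M.add_mem (hp m hm) (hq m hm)
    | mul p q _ _ hp hq => intro m hm; rw [mul_assoc]; exact hp _ (hq m hm)
  have h1M : (1 : D) ∈ M := by
    rw [← mul_one (1 : D)]; exact Submodule.mul_mem_mul K.one_mem L.one_mem
  have hle : Subalgebra.toSubmodule A ≤ M := fun s hs => by
    simpa using hAM s hs 1 h1M
  have : Module.Finite Z M := Module.Finite.iff_fg.mpr hM
  have : Finite M := Module.finite_of_finite Z
  have : Finite A := Finite.of_injective (Set.inclusion hle) (Set.inclusion_injective hle)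
  have hcomm := (Finite.isDomain_to_isField A).mul_comm
    ⟨a, Algebra.subset_adjoin (by simp)⟩ ⟨y, Algebra.subset_adjoin (by simp)⟩
  have hcomm : a * y = y * a := congrArg Subtype.val hcomm
  exact hca (mul_right_cancel₀ hy (by rw [hcomm, hyc]))

/-! ### Powers and the center in characteristic p. -/

theorem exists_pow_char_pow_not_mem_center {D : Type*} [DivisionRing D]
    (hnc : ∃ a b : D, a * b ≠ b * a) (p : ℕ) [Fact p.Prime] [CharP D p] (k : ℕ) :
    ∃ x : D, x ^ p ^ k ∉ Subring.center D := by
  by_contra! hx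
  have hpow : ∀ x : D, ∃ m : ℕ, x ^ p ^ m ∈ (algebraMap (Subring.center D) D).range :=
    fun x => ⟨k, ⟨⟨_, hx x⟩, rfl⟩⟩
  have hp : p ≠ 0 := (Fact.out : p.Prime).ne_zero
  have : Algebra.IsIntegral (Subring.center D) D := ⟨fun x =>
    IsIntegral.of_pow (pow_pos hp.bot_lt k) (isIntegral_algebraMap (x := (⟨_, hx x⟩ : Subring.center D)))⟩
  have : ExpChar (Subring.center D) p := by
    have : ExpChar D p := ExpChar.prime Fact.out
    exact ExpChar.expChar_center_iff.2 this
  have hpi : IsPurelyInseparable (Subring.center D) D :=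
    (isPurelyInseparable_iff_pow_mem _ p).2 hpow
  obtain ⟨a, b, hab⟩ := hnc
  obtain ⟨x, hxc, hxs⟩ := JacobsonNoether.exists_separable_and_not_isCentral D
    (fun h => hab (Subring.mem_center_iff.mp (h ▸ Subring.mem_top b) a))
  obtain ⟨z, rfl⟩ := hpi.inseparable' x hxs
  exact hxc z.2

open Polynomial in
theorem exists_eq_char_pow_of_add_one_pow {F : Type*} [Field F] [Infinite F] (p : ℕ)
    [Fact p.Prime] [CharP F p] {m : ℕ} (hm : m ≠ 0) (h : ∀ z : F, (z + 1) ^ m = z ^ m + 1) :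
    ∃ k, m = p ^ k := by
  obtain ⟨k, d, hpd, rfl⟩ := Nat.exists_eq_pow_mul_and_not_dvd hm p (Fact.out : p.Prime).ne_one
  have hd : (X + 1 : F[X]) ^ d = X ^ d + 1 := Polynomial.funext fun z => by
    have := h z
    rw [mul_comm, pow_mul, pow_mul] at this
    have e : (z ^ d) ^ p ^ k + 1 = (z ^ d + 1) ^ p ^ k := by rw [add_pow_char_pow, one_pow]
    rw [e] at this
    simpa using iterateFrobenius_inj F p k this
  have hd0 : (d : F) ≠ 0 := fun h0 => hpd ((CharP.cast_eq_zero_iff F p d).mp h0)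
  have e := congrArg (fun P => eval 0 (derivative P)) hd
  simp only [derivative_pow, derivative_add, derivative_X, derivative_one, eval_mul, eval_pow,
    eval_add, eval_X, eval_one, eval_C, zero_add, one_pow, add_zero, mul_one] at e
  -- Comparing derivatives at 0; as `0 ^ 0 = 1`, this forces `d = 1`.
  have e1 : (0 : F) ^ (d - 1) = 1 := mul_left_cancel₀ hd0 (by rw [← e, mul_one])
  refine ⟨k, ?_⟩
  rcases Nat.eq_zero_or_pos (d - 1) with h1 | h1
  · have : d ≠ 0 := by rintro rfl; simp at hpd
    rw [show d = 1 by omega, mul_one]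
  · rw [zero_pow h1.ne'] at e1
    exact absurd e1 zero_ne_one

open Polynomial in
/-- If a fixed power of every element is central and the center is infinite, then already the
`p`-part of the exponent makes every power central. -/
theorem exists_char_pow_mem_center {D : Type*} [DivisionRing D] [Infinite (Subring.center D)]
    (p : ℕ) [Fact p.Prime] [CharP D p] {n : ℕ} (hn : n ≠ 0)
    (h : ∀ x : D, x ^ n ∈ Subring.center D) : ∃ k, ∀ x : D, x ^ p ^ k ∈ Subring.center D := by
  obtain ⟨k, d, hpd, rfl⟩ := Nat.exists_eq_pow_mul_and_not_dvd hn p (Fact.out : p.Prime).ne_one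
  let Z := Subring.center D
  have : CharP Z p := (algebraMap Z D).charP Subtype.val_injective p
  have hd0 : (d : Z) ≠ 0 := fun h0 => hpd ((CharP.cast_eq_zero_iff Z p d).mp h0)
  have hd1 : 1 ≤ d := Nat.one_le_iff_ne_zero.mpr (by rintro rfl; simp at hpd)
  refine ⟨k, fun x => Subring.mem_center_iff.mpr fun y => ?_⟩
  set a := x ^ p ^ k
  rw [← sub_eq_zero, ← Module.forall_dual_apply_eq_zero_iff Z]
  intro φ
  -- `P` evaluates at `w` to `φ` of the commutator of `y` and `(a + w) ^ d`, which vanishes for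
  -- every p^k-th power `w`. Its coefficient in degree `d - 1` isolates `y * a - a * y`.
  let P : Z[X] := ∑ i ∈ Finset.range (d + 1), C (φ (y * a ^ i - a ^ i * y) * d.choose i) * X ^ (d - i)
  have hP : P = 0 := by
    refine eq_zero_of_infinite_isRoot P ((Set.infinite_range_of_injective
      (iterateFrobenius_inj Z p k)).mono ?_)
    rintro _ ⟨z, rfl⟩
    rw [iterateFrobenius_def]
    set w := z ^ p ^ k
    have hw : (a + (w : D)) ^ d ∈ Z := by
      have hc : Commute x (z : D) := Subring.mem_center_iff.mp z.2 x
      have := h (x + z)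
      rwa [pow_mul, add_pow_char_pow_of_commute p k hc] at this
    have hy := sub_eq_zero.mpr (Subring.mem_center_iff.mp hw y)
    have hca : Commute a (w : D) := Subring.mem_center_iff.mp w.2 a
    rw [hca.add_pow, Finset.mul_sum, Finset.sum_mul, ← Finset.sum_sub_distrib] at hy
    have hφ := congrArg φ hy
    rw [map_sum, map_zero] at hφ
    change P.eval w = 0
    rw [← hφ, eval_finsetSum]
    refine Finset.sum_congr rfl fun i _ => ?_
    have e : y * (a ^ i * (w : D) ^ (d - i) * (d.choose i : D)) -
        a ^ i * (w : D) ^ (d - i) * (d.choose i : D) * y =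
        (w ^ (d - i) * (d.choose i : Z)) • (y * a ^ i - a ^ i * y) := by
      have hz := Subring.mem_center_iff.mp (w ^ (d - i) * (d.choose i : Z)).2
      rw [Subring.smul_def, smul_eq_mul]
      push_cast at hz ⊢
      rw [mul_assoc (a ^ i), hz (a ^ i), mul_assoc _ (a ^ i) y, ← mul_assoc y, hz y, mul_sub]
      simp only [mul_assoc]
    rw [e, map_smul, smul_eq_mul]
    simp only [eval_mul, eval_C, eval_pow, eval_X]
    ring
  have hcoeff : P.coeff (d - 1) = φ (y * a - a * y) * d := by
    rw [finsetSum_coeff, Finset.sum_eq_single 1]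
    · rw [coeff_C_mul_X_pow, if_pos rfl, pow_one, Nat.choose_one_right]
    · intro i hi hi1
      rw [coeff_C_mul_X_pow, if_neg]
      rw [Finset.mem_range] at hi
      omega
    · intro h1; exact absurd (Finset.mem_range.mpr (by omega)) h1
  rw [hP, coeff_zero] at hcoeff
  exact (mul_eq_zero.mp hcoeff.symm).resolve_right hd0

theorem Subring.mem_center_of_mul_mem {D : Type*} [DivisionRing D] {z x : D}
    (hz : z ∈ Subring.center D) (hz0 : z ≠ 0) (h : z * x ∈ Subring.center D) :
    x ∈ Subring.center D := by
  rw [← inv_mul_cancel_left₀ hz0 x]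
  exact mul_mem (Set.inv_mem_center hz) h

/-! ### Excluding `h 1 = 1` in characteristic p. -/

namespace InversionSymmetric

variable {D : Type*} [DivisionRing D] {n : ℕ} {h : D →+ D}

theorem pow_mem_center (hs : InversionSymmetric n h) (hn : n ≠ 0) (h1 : h 1 = 1)
    (hh : ∀ x, h x ∈ Subring.center D) (x : D) : x ^ n ∈ Subring.center D := by
  rcases eq_or_ne x 0 with rfl | hx
  · rw [zero_pow hn]; exact zero_mem _
  rcases eq_or_ne (h x) 0 with h0 | h0
  · have := hs.apply_sq hn h1 x
    rw [h0, mul_zero, zero_sub] at this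
    rw [← neg_neg (x ^ n), ← this]
    exact neg_mem (hh _)
  · have e := hs x hx
    have h0' : h x⁻¹ ≠ 0 := fun h' => h0 (by rw [e, h', mul_zero])
    rw [← mul_inv_cancel_right₀ h0' (x ^ n), ← e]
    exact mul_mem (hh _) (Set.inv_mem_center (hh _))

open Polynomial in
theorem isIntegral (hs : InversionSymmetric n h) (hn : 2 < n) {l : D}
    (hl : l ∈ Subring.center D) (hl0 : l ≠ 0) (hh : ∀ x, h x - l * x ∈ Subring.center D) (x : D) :
    IsIntegral (Subring.center D) x := by
  rcases eq_or_ne x 0 with rfl | hx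
  · exact isIntegral_zero
  let l' : Subring.center D := ⟨l, hl⟩
  let u : Subring.center D := ⟨_, hh x⟩
  let v : Subring.center D := ⟨_, hh x⁻¹⟩
  -- The symmetry at `x` after substituting `h x = l * x + u`. Since `n > 2`, the exponents `n - 1`
  -- and 1 differ, so `l` survives as a coefficient.
  let P : (Subring.center D)[X] := C v * X ^ n + C l' * X ^ (n - 1) - C l' * X ^ 1 - C u * X ^ 0
  have hP0 : P ≠ 0 := fun h0 => by
    have e : P.coeff (n - 1) = l' := by
      simp only [P, coeff_sub, coeff_add, coeff_C_mul_X_pow]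
      rw [if_neg (by omega), if_pos trivial, if_neg (by omega), if_neg (by omega)]
      simp
    rw [h0, coeff_zero] at e
    exact hl0 (congrArg Subtype.val e.symm)
  have hPx : aeval x P = 0 := by
    have e1 : x ^ n * (l * x⁻¹) = l * x ^ (n - 1) := by
      obtain ⟨m, rfl⟩ := Nat.exists_eq_add_of_lt hn
      rw [← mul_assoc, Subring.mem_center_iff.mp hl, mul_assoc,
        show 2 + m + 1 - 1 = 2 + m by omega, pow_succ, mul_inv_cancel_right₀ hx]
    have e2 : x ^ n * (h x⁻¹ - l * x⁻¹) = h x - l * x ^ (n - 1) := by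
      rw [mul_sub, ← hs x hx, e1]
    simp only [P, map_sub, map_add, map_mul, aeval_C, map_pow, aeval_X, pow_one, pow_zero, mul_one]
    change (h x⁻¹ - l * x⁻¹) * x ^ n + l * x ^ (n - 1) - l * x - (h x - l * x) = 0
    rw [← Subring.mem_center_iff.mp (hh x⁻¹), e2]
    abel
  exact isAlgebraic_iff_isIntegral.mp ⟨P, hP0, hPx⟩

theorem two_mul_apply_of_mem_center (hs : InversionSymmetric n h) (hn : 2 < n)
    (h2 : (2 : D) ≠ 0) (h1 : h 1 = 1) {l : D} (hl : l ∈ Subring.center D) (hl0 : l ≠ 0)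
    (hh : ∀ x, h x - l * x ∈ Subring.center D) {w : D} (hw : w ∉ Subring.center D) {z : D}
    (hz : z ∈ Subring.center D) : 2 * h z = z + z ^ (n - 1) := by
  rcases eq_or_ne z 0 with rfl | hz0
  · rw [zero_pow (by omega)]; simp
  have hhz : h z ∈ Subring.center D := by
    rw [← sub_add_cancel (h z) (l * z)]; exact add_mem (hh z) (mul_mem hl hz)
  have hzi : z⁻¹ ∈ Subring.center D := Set.inv_mem_center hz
  have h2c : (2 : D) ∈ Subring.center D := ofNat_mem _ 2
  have e := hs.apply_central_mul h2 h1 hz hz0 w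
  rw [Subring.mem_center_iff.mp hhz (h w)] at e
  -- The coefficient of `w` in `apply_central_mul` once `h` is written as `l` times the identity
  -- plus a central part; it vanishes because `w` is not central.
  set κ := l * z + z ^ n * (l * z⁻¹) - 2 * (h z * l) with hκ
  have hκc : κ ∈ Subring.center D :=
    sub_mem (add_mem (mul_mem hl hz) (mul_mem (pow_mem hz n) (mul_mem hl hzi)))
      (mul_mem h2c (mul_mem hhz hl))
  have hκw : κ * w ∈ Subring.center D := by
    have : κ * w = 2 * (h z * (h w - l * w)) - (h (z * w) - l * (z * w)) -
        z ^ n * (h (z⁻¹ * w) - l * (z⁻¹ * w)) := by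
      simp only [mul_sub]
      rw [← e, hκ]
      simp only [sub_mul, add_mul, mul_assoc]
      abel
    rw [this]
    exact sub_mem (sub_mem (mul_mem h2c (mul_mem hhz (hh _))) (hh _)) (mul_mem (pow_mem hz n) (hh _))
  have hκ0 : κ = 0 := by
    by_contra h0; exact hw (Subring.mem_center_of_mul_mem hκc h0 hκw)
  have hzn : z ^ n * z⁻¹ = z ^ (n - 1) := by
    obtain ⟨m, rfl⟩ := Nat.exists_eq_add_of_lt hn
    rw [show 2 + m + 1 - 1 = 2 + m by omega, pow_succ, mul_inv_cancel_right₀ hz0]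
  have hκl : κ = (z + z ^ (n - 1) - 2 * h z) * l := by
    have hlc := Subring.mem_center_iff.mp hl
    rw [hκ, ← hlc z⁻¹, ← mul_assoc, hzn, ← hlc z]
    noncomm_ring
  rw [hκ0] at hκl
  exact (sub_eq_zero.mp ((mul_eq_zero.mp hκl.symm).resolve_right hl0)).symm

theorem char_pow_mem_center {p k : ℕ} [Fact p.Prime] [CharP D p] [Infinite (Subring.center D)]
    (hs : InversionSymmetric (p ^ k + 1) h) (hk : 1 < p ^ k) (h1 : h 1 = 1) {l : D}
    (hl : l ∈ Subring.center D) (hh : ∀ x, h x - l * x ∈ Subring.center D)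
    (hz : ∀ z ∈ Subring.center D, 2 * h z = z + z ^ p ^ k) {w : D} (hw : w ∉ Subring.center D)
    (x : D) : x ^ p ^ k ∈ Subring.center D := by
  have hsq (x : D) : h (x ^ 2) = (x ^ p ^ k + x) * h x - x ^ p ^ k * x := by
    rw [hs.apply_sq (by omega) h1, pow_succ (x + 1),
      add_pow_char_pow_of_commute p k (Commute.one_right x), one_pow, pow_succ]
    noncomm_ring
  obtain ⟨z, hzz⟩ : ∃ z : Subring.center D, z ^ p ^ k ≠ z := by
    by_contra! hall
    refine Polynomial.X_ne_zero (R := Subring.center D) ?_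
    have : (Polynomial.X ^ p ^ k : Polynomial (Subring.center D)) = Polynomial.X :=
      Polynomial.funext fun z => by simpa using hall z
    have := congrArg Polynomial.natDegree this
    rw [Polynomial.natDegree_X_pow, Polynomial.natDegree_X] at this
    omega
  have hzc : (z : D) ∈ Subring.center D := z.2
  set l' : Subring.center D := ⟨l, hl⟩
  have hsub : z ^ p ^ k - z ≠ 0 := sub_ne_zero.mpr hzz
  -- Linearize the square formula at `x + z`; modulo the center, `z ^ p ^ k - z` factors out.
  have key (x : D) : x ^ p ^ k + (2 * l' - 1) • x ∈ Subring.center D := by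
    have hcx : Commute x (z : D) := Subring.mem_center_iff.mp hzc x
    have e1 := hsq (x + z)
    have e2 : (x + z) ^ 2 = x ^ 2 + (2 : Subring.center D) • (z * x) + (z : D) ^ 2 := by
      rw [two_smul, pow_two, mul_add, add_mul, add_mul, hcx.eq]; noncomm_ring
    rw [e2, two_smul, add_pow_char_pow_of_commute p k hcx] at e1
    simp only [map_add, hsq] at e1
    have e3 : h (z * x) + h (z * x) = (x ^ p ^ k + x) * h z + ((z : D) ^ p ^ k + z) * h x -
        x ^ p ^ k * z - z ^ p ^ k * x := by
      rw [← sub_eq_zero] at e1 ⊢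
      rw [← e1]; noncomm_ring
    have e4 : 2 * (h (z * x) + h (z * x)) = (x ^ p ^ k + x) * (z + (z : D) ^ p ^ k) +
        2 * (((z : D) ^ p ^ k + z) * h x - x ^ p ^ k * z - z ^ p ^ k * x) := by
      rw [e3, ← hz z hzc]; noncomm_ring
    set W : Subring.center D := z ^ p ^ k
    set μ : Subring.center D := ⟨_, hh x⟩ with hμ
    set ν : Subring.center D := ⟨_, hh (z * x)⟩ with hν
    have hx : h x = l' • x + μ • (1 : D) := by
      simp [hμ, Subring.smul_def, l']
    have hzx : h (z * x) = l' • z • x + ν • (1 : D) := by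
      simp [hν, Subring.smul_def, l']
    have cl (c : Subring.center D) (y : D) : (c : D) * y = c • y := rfl
    have cr (c : Subring.center D) (y : D) : y * (c : D) = c • y :=
      Subring.mem_center_iff.mp c.2 y
    have hWD : (z : D) ^ p ^ k = (W : D) := rfl
    rw [hx, hzx, hWD] at e4
    simp only [two_mul, mul_add, add_mul, cr, cl] at e4
    have e5 : ((W - z) : Subring.center D) • (x ^ p ^ k + (2 * l' - 1) • x) =
        (4 * ν - 2 * (W + z) * μ) • (1 : D) := by
      linear_combination (norm := module) (-1 : Subring.center D) • e4
    refine Subring.mem_center_of_mul_mem (W - z).2 (fun h0 => hsub (Subtype.ext h0)) ?_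
    rw [cl, e5, ← cl, mul_one]
    exact Subtype.property _
  have hα : 2 * l' - 1 = 0 := by
    by_contra h0
    have hcw : Commute (z : D) w := (Subring.mem_center_iff.mp hzc w).symm
    -- The p-power terms cancel, leaving a central multiple of the noncentral `w`.
    have e := sub_mem (key (z * w)) (mul_mem (pow_mem hzc (p ^ k)) (key w))
    have e' : (z * w) ^ p ^ k + (2 * l' - 1) • (z * w) -
        (z : D) ^ p ^ k * (w ^ p ^ k + (2 * l' - 1) • w) =
        (((2 * l' - 1) * (z - z ^ p ^ k) : Subring.center D) : D) * w := by
      rw [hcw.mul_pow, mul_add, mul_smul_comm, add_sub_add_left_eq_sub, ← smul_sub, ← sub_mul]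
      rw [Subring.smul_def, smul_eq_mul, ← mul_assoc]
      push_cast
      rfl
    rw [e'] at e
    refine hw (Subring.mem_center_of_mul_mem (Subtype.property _) (fun h' => ?_) e)
    exact mul_ne_zero h0 (sub_ne_zero.mpr hzz.symm) (Subtype.ext h')
  have := key x
  rwa [hα, zero_smul, add_zero] at this

theorem apply_one_ne_one_of_charP (hs : InversionSymmetric n h) (hn : 2 < n)
    (hnc : ∃ a b : D, a * b ≠ b * a) (h2 : (2 : D) ≠ 0) (p : ℕ) [Fact p.Prime] [CharP D p] :
    h 1 ≠ 1 := by
  intro h1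
  obtain ⟨l, hl, hh⟩ := exists_central_mul_add_of_commuting hnc h fun x y => by
    rw [hs.apply_commutator h2 h1, ← neg_sub (h y * x), hs.apply_commutator h2 h1, ← map_neg,
      neg_sub]
  rcases eq_or_ne l 0 with rfl | hl0
  · have hpow := hs.pow_mem_center (by omega) h1 (by simpa using hh)
    have := not_finite_center hnc fun x => IsIntegral.of_pow (by omega : 0 < n)
      (isIntegral_algebraMap (x := (⟨_, hpow x⟩ : Subring.center D)))
    obtain ⟨k, hk⟩ := exists_char_pow_mem_center p (by omega) hpow
    obtain ⟨x, hx⟩ := exists_pow_char_pow_not_mem_center hnc p k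
    exact hx (hk x)
  · have := not_finite_center hnc (hs.isIntegral hn hl hl0 hh)
    obtain ⟨w, b, hwb⟩ := id hnc
    have hw : w ∉ Subring.center D := fun h => hwb (Subring.mem_center_iff.mp h b).symm
    have hz (z : D) (hz : z ∈ Subring.center D) :=
      hs.two_mul_apply_of_mem_center hn h2 h1 hl hl0 hh hw hz
    have : CharP (Subring.center D) p :=
      (algebraMap (Subring.center D) D).charP Subtype.val_injective p
    obtain ⟨k, hk⟩ := exists_eq_char_pow_of_add_one_pow (F := Subring.center D) p
      (by omega : n - 1 ≠ 0) fun z => Subtype.ext (by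
        have e := hz (z + 1) (add_mem z.2 (one_mem _))
        rw [map_add, mul_add, hz z z.2, h1, ← sub_eq_zero] at e
        push_cast
        rw [← sub_eq_zero, ← neg_eq_zero, ← e]
        noncomm_ring)
    obtain rfl : n = p ^ k + 1 := by omega
    obtain ⟨x, hx⟩ := exists_pow_char_pow_not_mem_center hnc p k
    exact hx (hs.char_pow_mem_center (by omega) h1 hl hh hz hw x)

end InversionSymmetric

theorem proposition5p6 {D : Type*} [DivisionRing D]
    (hnc : ∃ a b : D, a * b ≠ b * a) (hchar : ringChar D ≠ 2)
    (n : ℕ) (hn : 2 < n) (f g : D →+ D)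
    (hfg : ∀ x : Dˣ, f (x : D) = (x : D) ^ n * g ((x⁻¹ : Dˣ) : D)) :
    f = -g := by
  have h2 : (2 : D) ≠ 0 := Ring.two_ne_zero hchar
  have hfg' (x : D) (hx : x ≠ 0) : f x = x ^ n * g x⁻¹ := by simpa using hfg (Units.mk0 x hx)
  have hs : InversionSymmetric n (f + g) := fun x hx => by
    have e := hfg' _ (inv_ne_zero hx)
    rw [inv_inv, inv_pow] at e
    rw [AddMonoidHom.add_apply, AddMonoidHom.add_apply, mul_add, ← hfg' x hx, e,
      mul_inv_cancel_left₀ (pow_ne_zero n hx), add_comm]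
  have hone : (f + g) 1 = 0 := by
    by_contra hc
    have hs' := hs.mul_right ((f + g) 1)⁻¹
    rcases CharP.char_is_prime_or_zero D (ringChar D) with hp | hp
    · have : Fact (ringChar D).Prime := ⟨hp⟩
      exact hs'.apply_one_ne_one_of_charP hn hnc h2 (ringChar D) (by
        exact mul_inv_cancel₀ hc)
    · have : CharP D 0 := hp ▸ ringChar.charP D
      have : CharZero D := CharP.charP_to_charZero D
      have e := (mul_eq_zero.mp (hs.two_pow_mul_apply_one h2 hn.le)).resolve_right hc
      have e' : 2 ^ (n - 2) = 1 := by exact_mod_cast sub_eq_zero.mp e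
      exact absurd (Nat.one_lt_two_pow (by omega : n - 2 ≠ 0)) (by omega)
  exact eq_neg_of_add_eq_zero_left (AddMonoidHom.ext (hs.apply_eq_zero h2 hone))
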